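/- Let $(\Omega,\mu)$ be an arbitrary probability space. A \emph{graphon} on $\Omega$ is a measurable symmetric function $W:\Omega^2\to[0,1]$. For an integrable function $U$ on $\Omega^2$ let $\|U\|_\square=\sup_{S,T}\bigl|\int_{S\times T}U\,d\mu^2\bigr|$, the supremum being over all measurable $S,T\subseteq\Omega$. For graphons $W_1,W_2$ on probability spaces $(\Omega_1,\mu_1)$, $(\Omega_2,\mu_2)$ (possibly different) let $$\delta_\square(W_1,W_2)=\inf\bigl\|W_1(\varphi_1(x),\varphi_1(y))-W_2(\varphi_2(x),\varphi_2(y))\bigr\|_\square ,$$ where the infimum is over all pairs of measure-preserving maps $\varphi_i:\Omega'\to\Omega_i$, $i=1,2$, defined on a common, arbitrary probability space $\Omega'$. For a finite loopless multigraph $F$ (parallel edges allowed) with vertex set $V(F)$ and edge multiset $E(F)$, and a graphon $W$ on $(\Omega,\mu)$, let $$t(F,W)=\int_{\Omega^{V(F)}}\prod_{ij\in E(F)}W(x_i,x_j)\prod_{i\in V(F)}d\mu(x_i).$$ \textbf{Theorem.} Let $W$ be a graphon on a probability space $(\Omega,\mu)$. Then the following are equivalent. (i) $W$ is random-free, i.e.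 $W(x,y)\in\{0,1\}$ for $\mu^2$-a.e. $(x,y)\in\Omega^2$. (ii) $\int W_n^2\to\int W^2$ whenever $(W_n)_n$ is a sequence of graphons, each defined on some probability space $(\Omega_n,\mu_n)$, such that $\delta_\square(W_n,W)\to0$; here $\int W_n^2=\int_{\Omega_n^2}W_n^2\,d\mu_n^2$ and $\int W^2=\int_{\Omega^2}W^2\,d\mu^2$. (iii) $t(F,W_n)\to t(F,W)$ for every finite loopless multigraph $F$ whenever $(W_n)_n$ is a sequence of graphons, each defined on some probability space, such that $\delta_\square(W_n,W)\to0$. -/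

import Mathlib

open MeasureTheory Filter Topology

universe u v w

/-- A graphon on the measurable space `Ω`: a symmetric function `Ω × Ω → [0,1]`, measurable for
the product `σ`-algebra. The probability measure on `Ω` is an argument of the notions below. -/
structure Graphon (Ω : Type u) [MeasurableSpace Ω] where
  toFun : Ω → Ω → ℝ
  measurable' : Measurable (Function.uncurry toFun)
  symm' : ∀ x y, toFun x y = toFun y x
  mem_Icc' : ∀ x y, toFun x y ∈ Set.Icc (0 : ℝ) 1

namespace Graphon

instance {Ω : Type u} [MeasurableSpace Ω] : CoeFun (Graphon Ω) (fun _ => Ω → Ω → ℝ) :=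
  ⟨Graphon.toFun⟩

/-- A graphon is random-free if it takes values in `{0, 1}` almost everywhere. -/
def IsRandomFree {Ω : Type u} [MeasurableSpace Ω] (μ : Measure Ω) (W : Graphon Ω) : Prop :=
  ∀ᵐ p ∂(μ.prod μ), W p.1 p.2 = 0 ∨ W p.1 p.2 = 1

end Graphon

/-- The cut norm of a function `U` on `Ω × Ω`: the supremum of `|∫_{S × T} U|` over all
measurable `S, T ⊆ Ω`. -/
noncomputable def cutNorm {Ω : Type u} [MeasurableSpace Ω] (μ : Measure Ω)
    (U : Ω → Ω → ℝ) : ℝ :=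
  sSup {r : ℝ | ∃ S T : Set Ω, MeasurableSet S ∧ MeasurableSet T ∧
    r = |∫ p in S ×ˢ T, U p.1 p.2 ∂(μ.prod μ)|}

/-- The cut metric between graphons on two (possibly different) probability spaces: the infimum
of `‖W₁^φ₁ - W₂^φ₂‖_□` over all couplings, i.e. over all pairs of measure-preserving maps
`φ₁ : Ω → Ω₁`, `φ₂ : Ω → Ω₂` defined on a common probability space `(Ω, μ)`. -/
noncomputable def cutDist {Ω₁ : Type u} {Ω₂ : Type v} [MeasurableSpace Ω₁] [MeasurableSpace Ω₂]
    (μ₁ : Measure Ω₁) (W₁ : Graphon Ω₁) (μ₂ : Measure Ω₂) (W₂ : Graphon Ω₂) : ℝ :=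
  sInf {r : ℝ | ∃ (Ω : Type (max u v)) (_ : MeasurableSpace Ω) (μ : Measure Ω)
    (φ₁ : Ω → Ω₁) (φ₂ : Ω → Ω₂), IsProbabilityMeasure μ ∧
      MeasurePreserving φ₁ μ μ₁ ∧ MeasurePreserving φ₂ μ μ₂ ∧
      r = cutNorm μ (fun x y => W₁ (φ₁ x) (φ₁ y) - W₂ (φ₂ x) (φ₂ y))}

namespace Graphon

/-- The factor `W(x_i, x_j)` that an edge `e` with ends `i, j` of a multigraph `F` contributes to
the homomorphism density. The order of the two ends is immaterial since `W` is symmetric, see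
`edgeFactor_eq`. -/
noncomputable def edgeFactor {Ω : Type u} [MeasurableSpace Ω] (W : Graphon Ω)
    {V : Type v} {E : Type w} (F : Graph V E) (x : F.vertexSet → Ω) (e : F.edgeSet) : ℝ :=
  have h := F.exists_isLink_of_mem_edgeSet e.2
  W (x ⟨h.choose, h.choose_spec.choose_spec.left_mem⟩)
    (x ⟨h.choose_spec.choose, h.choose_spec.choose_spec.right_mem⟩)

theorem edgeFactor_eq {Ω : Type u} [MeasurableSpace Ω] (W : Graphon Ω)
    {V : Type v} {E : Type w} (F : Graph V E) (x : F.vertexSet → Ω) (e : F.edgeSet)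
    (i j : F.vertexSet) (h : F.IsLink e i j) : W.edgeFactor F x e = W (x i) (x j) := by
  have h' := F.exists_isLink_of_mem_edgeSet e.2
  rcases h.eq_and_eq_or_eq_and_eq h'.choose_spec.choose_spec with ⟨h1, h2⟩ | ⟨h1, h2⟩
  · have e1 : i = ⟨h'.choose, h'.choose_spec.choose_spec.left_mem⟩ := Subtype.ext h1
    have e2 : j = ⟨h'.choose_spec.choose, h'.choose_spec.choose_spec.right_mem⟩ := Subtype.ext h2
    rw [e1, e2]
    rfl
  · have e1 : i = ⟨h'.choose_spec.choose, h'.choose_spec.choose_spec.right_mem⟩ := Subtype.ext h1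
    have e2 : j = ⟨h'.choose, h'.choose_spec.choose_spec.left_mem⟩ := Subtype.ext h2
    rw [e1, e2, W.symm']
    rfl

/-- The homomorphism density
`t(F, W) = ∫_{Ω^{V(F)}} ∏_{ij ∈ E(F)} W(x_i, x_j) ∏_{i ∈ V(F)} dμ(x_i)` of a finite multigraph
`F` (parallel edges are counted with multiplicity). -/
noncomputable def homDensity {V : Type v} {E : Type w} (F : Graph V E)
    [Fintype F.vertexSet] [Fintype F.edgeSet]
    {Ω : Type u} [MeasurableSpace Ω] (μ : Measure Ω) (W : Graphon Ω) : ℝ :=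
  ∫ x : F.vertexSet → Ω, ∏ e : F.edgeSet, W.edgeFactor F x e ∂(Measure.pi fun _ => μ)

end Graphon

/-!
A coupling of two graphons moves both to one probability space without changing integrals or
homomorphism densities, so two graphons may be compared on the same space.

*Random-free graphons are continuity points.* Let `W` be random-free and let `V` be a graphon on the
same space, close to `W` in the cut norm. Since `W ∈ {0, 1}` almost everywhere,
`|V - W| = (V - W) (1 - 2 W)`. The factor `1 - 2 W` is approximated in `L¹` by a function which is
constant on the cells of a finite grid of rectangles, and against such a function the integral of
`V - W` is at most a constant, depending only on the step function, times the cut norm. So cut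
convergence to `W` is `L¹` convergence (`Graphon.IsRandomFree.exists_integral_abs_sub_le`), and for
a loopless `F` the difference of the densities is at most the number of edges times the `L¹`
distance (`Graphon.abs_homDensity_sub_le`).

*Densities give squares.* The multigraph with two vertices and two parallel edges has density
`∫ W²`.

*Convergence of squares forces random-freeness.* Every graphon `W` is a limit in the cut metric of
`{0, 1}`-valued graphons `G n` (`exists_zero_one_graphon_cutDist_le`). Then
`∫ (G n)² = ∫ G n → ∫ W`, so `∫ W² = ∫ W`, and `W (1 - W)` vanishes almost everywhere. For the
approximation, `W` is replaced by a step function with values `H i j`, and each step by an explicit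
quasi-random graph on `(ZMod q)²`, `q` prime: `a` and `b` are adjacent if
`a₁ b₁ + a₂ + b₂` lies in a set of about `q * H i j` residues. This pairing is symmetric, and its
values at `b` and `b'` are independent and uniform as functions of `a` if `b₁ ≠ b'₁`; the second
moment method then bounds the cut norm of the deviation from the mean density by `1 / √q`
(`abs_sum_affinePairing_le`). The approximating graphons live on finite spaces, hence in any
universe.
-/

/-! ### Functions constant on the cells of a finite grid -/

/-- A function on `Ω × Ω` is a step function if it is constant on the products of the classes of a
finite measurable partition of `Ω`. The partition is given by the map `c` to its index type. The
values may lie in any type, so that a set is described by its membership predicate. -/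
def IsStepFun {Ω : Type u} [MeasurableSpace Ω] {β : Type w} (f : Ω × Ω → β) : Prop :=
  ∃ (ι : Type) (_ : Fintype ι) (c : Ω → ι) (H : ι → ι → β),
    (∀ i, MeasurableSet (c ⁻¹' {i})) ∧ ∀ p, f p = H (c p.1) (c p.2)

namespace IsStepFun

variable {Ω : Type u} [MeasurableSpace Ω] {β γ δ : Type*}

theorem map₂ {f : Ω × Ω → β} {g : Ω × Ω → γ} (hf : IsStepFun f) (hg : IsStepFun g)
    (F : β → γ → δ) : IsStepFun fun p => F (f p) (g p) := by
  obtain ⟨ι, _, c, H, hc, hH⟩ := hf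
  obtain ⟨κ, _, d, K, hd, hK⟩ := hg
  refine ⟨ι × κ, inferInstance, fun x => (c x, d x), fun i j => F (H i.1 j.1) (K i.2 j.2), ?_, ?_⟩
  · rintro ⟨i, j⟩
    convert (hc i).inter (hd j) using 1
    ext x
    simp
  · intro p
    simp [hH, hK]

theorem map {f : Ω × Ω → β} (hf : IsStepFun f) (F : β → γ) : IsStepFun fun p => F (f p) :=
  hf.map₂ hf fun b _ => F b

theorem measurable [MeasurableSpace β] {f : Ω × Ω → β} (hf : IsStepFun f) : Measurable f := by
  obtain ⟨ι, _, c, H, hc, hH⟩ := hf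
  let _ : MeasurableSpace ι := ⊤
  have : DiscreteMeasurableSpace ι := ⟨fun _ => trivial⟩
  have hcm : Measurable c := measurable_to_countable' hc
  have : f = (fun q : ι × ι => H q.1 q.2) ∘ fun p => (c p.1, c p.2) := funext hH
  rw [this]
  exact (Measurable.of_discrete).comp (by fun_prop)

theorem exists_norm_le {f : Ω × Ω → ℝ} (hf : IsStepFun f) : ∃ C, ∀ p, ‖f p‖ ≤ C := by
  obtain ⟨ι, _, c, H, hc, hH⟩ := hf
  obtain ⟨C, hC⟩ := (Set.finite_range fun i : ι × ι => ‖H i.1 i.2‖).bddAbove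
  exact ⟨C, fun p => hH p ▸ hC ⟨(c p.1, c p.2), rfl⟩⟩

theorem integrable {f : Ω × Ω → ℝ} (hf : IsStepFun f) (m : Measure (Ω × Ω)) [IsFiniteMeasure m] :
    Integrable f m := by
  obtain ⟨C, hC⟩ := hf.exists_norm_le
  exact .of_bound hf.measurable.aestronglyMeasurable C (.of_forall hC)

theorem mem_prod {A B : Set Ω} (hA : MeasurableSet A) (hB : MeasurableSet B) :
    IsStepFun fun p : Ω × Ω => p ∈ A ×ˢ B := by
  refine ⟨Prop × Prop, inferInstance, fun x => (x ∈ A, x ∈ B), fun i j => i.1 ∧ j.2, ?_, ?_⟩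
  · rintro ⟨i, j⟩
    by_cases hi : i <;> by_cases hj : j
    · convert hA.inter hB using 1
      ext x; simp [hi, hj]
    · convert hA.inter hB.compl using 1
      ext x; simp [hi, hj]
    · convert hA.compl.inter hB using 1
      ext x; simp [hi, hj]
    · convert hA.compl.inter hB.compl using 1
      ext x; simp [hi, hj]
  · exact fun p => rfl

theorem const (b : β) : IsStepFun fun _ : Ω × Ω => b :=
  ⟨Unit, inferInstance, fun _ => (), fun _ _ => b, by simp, by simp⟩

/-- Step sets form a ring of sets which contains the rectangles, so they are dense among the
measurable subsets of `Ω × Ω`. -/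
theorem exists_measure_symmDiff_lt (μ : Measure Ω) [IsProbabilityMeasure μ] {A : Set (Ω × Ω)}
    (hA : MeasurableSet A) {ε : ENNReal} (hε : 0 < ε) :
    ∃ B : Set (Ω × Ω), IsStepFun (fun p => p ∈ B) ∧ μ.prod μ (symmDiff B A) < ε := by
  have hring : IsSetRing {B : Set (Ω × Ω) | IsStepFun fun p => p ∈ B} :=
    { empty_mem := const False
      union_mem := fun s t hs ht => hs.map₂ ht Or
      sdiff_mem := fun s t hs ht => hs.map₂ ht fun a b => a ∧ ¬ b }
  have hgen : (inferInstance : MeasurableSpace (Ω × Ω)) =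
      MeasurableSpace.generateFrom {B : Set (Ω × Ω) | IsStepFun fun p => p ∈ B} := by
    apply le_antisymm
    · rw [← generateFrom_prod]
      refine MeasurableSpace.generateFrom_mono ?_
      rintro _ ⟨s, hs, t, ht, rfl⟩
      exact mem_prod hs ht
    · exact MeasurableSpace.generateFrom_le fun s hs => measurableSet_setOfPred.2 hs.measurable
  exact exists_measure_symmDiff_lt_of_generateFrom_isSetRing hring
    ⟨{Set.univ}, Set.countable_singleton _, by simpa using const True, by simp⟩ hgen hA hε

theorem exists_integral_abs_sub_le (μ : Measure Ω) [IsProbabilityMeasure μ] {f : Ω × Ω → ℝ}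
    (hf : Integrable f (μ.prod μ)) {ε : ℝ} (hε : 0 < ε) :
    ∃ g : Ω × Ω → ℝ, IsStepFun g ∧ Integrable g (μ.prod μ) ∧
      ∫ p, |f p - g p| ∂(μ.prod μ) ≤ ε := by
  have hind : ∀ (b : ℝ) ⦃s : Set (Ω × Ω)⦄, MeasurableSet s → μ.prod μ s < ⊤ →
      ∀ {ε : ENNReal}, ε ≠ 0 → ∃ g : Ω × Ω → ℝ,
        eLpNorm (g - s.indicator fun _ => b) 1 (μ.prod μ) ≤ ε ∧
          IsStepFun g ∧ Integrable g (μ.prod μ) := by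
    intro b s hs _ ε hε
    obtain ⟨η, hη, hη'⟩ := exists_eLpNorm_indicator_le (μ := μ.prod μ) ENNReal.one_ne_top b hε
    obtain ⟨B, hB, hBs⟩ := exists_measure_symmDiff_lt μ hs (ENNReal.coe_pos.2 hη)
    have hBm : MeasurableSet B := measurableSet_setOfPred.2 hB.measurable
    refine ⟨B.indicator fun _ => b, ?_, ?_, (integrable_const b).indicator hBm⟩
    · rw [eLpNorm_indicator_sub_indicator]
      exact hη' _ hBs.le
    · classical
      convert hB.map fun h => if h then b else 0 using 2
      exact Set.indicator_apply _ _ _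
  obtain ⟨g, hfg, hg, hgi⟩ := (memLp_one_iff_integrable.2 hf).induction_dense
    ENNReal.one_ne_top (fun g => IsStepFun g ∧ Integrable g (μ.prod μ)) hind
    (fun f g hf hg => ⟨hf.1.map₂ hg.1 (· + ·), hf.2.add hg.2⟩)
    (fun f hf => hf.2.aestronglyMeasurable) (ENNReal.ofReal_pos.2 hε).ne'
  refine ⟨g, hg, hgi, ?_⟩
  have h1 : eLpNorm (f - g) 1 (μ.prod μ) = ENNReal.ofReal (∫ p, |f p - g p| ∂(μ.prod μ)) := by
    rw [eLpNorm_one_eq_lintegral_enorm, ← ofReal_integral_norm_eq_lintegral_enorm (hf.sub hgi)]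
    rfl
  rw [h1] at hfg
  exact (ENNReal.ofReal_le_ofReal_iff hε.le).1 hfg

end IsStepFun

/-- A graphon is approximated in `L¹` by a symmetric step function with values in `[0, 1]`:
clamping and symmetrizing an arbitrary approximation does not make it worse. -/
theorem Graphon.exists_step_approx {Ω : Type u} [MeasurableSpace Ω] (μ : Measure Ω)
    [IsProbabilityMeasure μ] (W : Graphon Ω) {ε : ℝ} (hε : 0 < ε) :
    ∃ (ι : Type) (_ : Fintype ι) (c : Ω → ι) (H : ι → ι → ℝ),
      (∀ i, MeasurableSet (c ⁻¹' {i})) ∧ (∀ i j, H i j = H j i) ∧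
      (∀ i j, H i j ∈ Set.Icc (0 : ℝ) 1) ∧
      ∫ p, |W p.1 p.2 - H (c p.1) (c p.2)| ∂(μ.prod μ) ≤ ε := by
  have hW : Integrable (fun p : Ω × Ω => W p.1 p.2) (μ.prod μ) :=
    Integrable.of_mem_Icc 0 1 W.measurable'.aemeasurable (.of_forall fun p => W.mem_Icc' _ _)
  obtain ⟨g, ⟨ι, hι, c, H, hc, hH⟩, hgi, hg⟩ := IsStepFun.exists_integral_abs_sub_le μ hW hε
  set P : ℝ → ℝ := fun r => max 0 (min 1 r) with hP
  have hPmem : ∀ r, P r ∈ Set.Icc (0 : ℝ) 1 := fun r => by simp [hP]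
  -- clamping to `[0, 1]` does not increase the distance to a point of `[0, 1]`
  have hPle : ∀ r, ∀ s ∈ Set.Icc (0 : ℝ) 1, |s - P r| ≤ |s - r| := by
    intro r s hs
    have : s = P s := by simp [hP, hs.1, hs.2]
    calc |s - P r| = |P s - P r| := by rw [← this]
      _ ≤ |min 1 s - min 1 r| := by
          simpa [hP, max_comm] using abs_max_sub_max_le_abs (min 1 s) (min 1 r) 0
      _ ≤ |s - r| := by simpa using abs_min_sub_min_le_max 1 s 1 r
  refine ⟨ι, hι, c, fun i j => (P (H i j) + P (H j i)) / 2, hc, fun i j => by simp only [add_comm],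
    fun i j => ?_, ?_⟩
  · have h1 := hPmem (H i j)
    have h2 := hPmem (H j i)
    constructor <;> linarith [h1.1, h1.2, h2.1, h2.2]
  · have hd : Integrable (fun p => |W p.1 p.2 - g p|) (μ.prod μ) := (hW.sub hgi).abs
    calc _ ≤ ∫ p, (|W p.1 p.2 - g p| + |W p.swap.1 p.swap.2 - g p.swap|) / 2 ∂(μ.prod μ) := by
          refine integral_mono_of_nonneg (.of_forall fun _ => abs_nonneg _)
            ((hd.add hd.swap).div_const 2) (.of_forall fun p => ?_)
          simp only [hH, Prod.fst_swap, Prod.snd_swap, W.symm' p.2 p.1]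
          have h1 := hPle (H (c p.1) (c p.2)) _ (W.mem_Icc' p.1 p.2)
          have h2 := hPle (H (c p.2) (c p.1)) _ (W.mem_Icc' p.1 p.2)
          have h3 := abs_add_le (W p.1 p.2 - P (H (c p.1) (c p.2)))
            (W p.1 p.2 - P (H (c p.2) (c p.1)))
          rw [show W p.1 p.2 - (P (H (c p.1) (c p.2)) + P (H (c p.2) (c p.1))) / 2 =
            ((W p.1 p.2 - P (H (c p.1) (c p.2))) + (W p.1 p.2 - P (H (c p.2) (c p.1)))) / 2 by ring,
            abs_div, abs_two]
          linarith
      _ = ∫ p, |W p.1 p.2 - g p| ∂(μ.prod μ) := by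
          have h := integral_add hd hd.swap
          simp only [Function.comp_def] at h
          rw [integral_div, h, integral_prod_swap (fun p => |W p.1 p.2 - g p|)]
          ring
      _ ≤ ε := hg

/-! ### The cut norm and the cut metric -/

theorem setIntegral_mul_step_eq_sum {Ω : Type u} [MeasurableSpace Ω] (μ : Measure Ω)
    {ι : Type*} [Fintype ι] {c : Ω → ι} (hc : ∀ i, MeasurableSet (c ⁻¹' {i})) (H : ι → ι → ℝ)
    {U : Ω × Ω → ℝ} (hU : Integrable U (μ.prod μ)) (S T : Set Ω) :
    ∫ p in S ×ˢ T, U p * H (c p.1) (c p.2) ∂(μ.prod μ) =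
      ∑ i, ∑ j, H i j * ∫ p in (c ⁻¹' {i} ∩ S) ×ˢ (c ⁻¹' {j} ∩ T), U p ∂(μ.prod μ) := by
  classical
  have hm : ∀ i j, MeasurableSet ((c ⁻¹' {i}) ×ˢ (c ⁻¹' {j})) := fun i j => (hc i).prod (hc j)
  have h : ∀ p, U p * H (c p.1) (c p.2) =
      ∑ i, ∑ j, H i j * ((c ⁻¹' {i}) ×ˢ (c ⁻¹' {j})).indicator U p := by
    intro p
    rw [Finset.sum_eq_single (c p.1), Finset.sum_eq_single (c p.2)]
    · simp [mul_comm]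
    · intro j _ hj; simp [hj.symm]
    · simp
    · intro i _ hi; exact Finset.sum_eq_zero fun j _ => by simp [hi.symm]
    · simp
  have hi : ∀ i j, Integrable (fun p => H i j * ((c ⁻¹' {i}) ×ˢ (c ⁻¹' {j})).indicator U p)
      ((μ.prod μ).restrict (S ×ˢ T)) :=
    fun i j => ((hU.indicator (hm i j)).restrict).const_mul _
  simp_rw [h]
  rw [integral_finsetSum _ fun i _ => integrable_finsetSum _ fun j _ => hi i j]
  refine Finset.sum_congr rfl fun i _ => ?_
  rw [integral_finsetSum _ fun j _ => hi i j]
  refine Finset.sum_congr rfl fun j _ => ?_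
  rw [integral_const_mul, integral_indicator (hm i j), Measure.restrict_restrict (hm i j),
    Set.prod_inter_prod]

theorem abs_setIntegral_le_integral_abs {Ω : Type*} [MeasurableSpace Ω] {μ : Measure Ω} {U : Ω → ℝ}
    (hU : Integrable U μ) (R : Set Ω) : |∫ p in R, U p ∂μ| ≤ ∫ p, |U p| ∂μ :=
  (abs_integral_le_integral_abs).trans
    (setIntegral_le_integral hU.abs (.of_forall fun _ => abs_nonneg _))

theorem MeasureTheory.MeasurePreserving.integral_comp_prod {Ω : Type u} {Ω' : Type v}
    [MeasurableSpace Ω] [MeasurableSpace Ω'] {μ : Measure Ω} {m : Measure Ω'} [SFinite μ]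
    [SFinite m]
    {φ : Ω' → Ω} (hφ : MeasurePreserving φ m μ) {f : Ω → Ω → ℝ}
    (hf : Measurable fun p : Ω × Ω => f p.1 p.2) :
    ∫ p, f (φ p.1) (φ p.2) ∂(m.prod m) = ∫ p, f p.1 p.2 ∂(μ.prod μ) := by
  have h := hφ.prod hφ
  rw [← h.map_eq, integral_map h.measurable.aemeasurable hf.aestronglyMeasurable]
  rfl

section CutNorm

variable {Ω : Type u} [MeasurableSpace Ω] {μ : Measure Ω} {U : Ω → Ω → ℝ}

theorem cutNorm_nonneg : 0 ≤ cutNorm μ U := by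
  refine Real.sSup_nonneg ?_
  rintro _ ⟨S, T, -, -, rfl⟩
  exact abs_nonneg _

theorem cutNorm_le {r : ℝ} (h : ∀ S T : Set Ω, MeasurableSet S → MeasurableSet T →
    |∫ p in S ×ˢ T, U p.1 p.2 ∂(μ.prod μ)| ≤ r) : cutNorm μ U ≤ r := by
  refine csSup_le ⟨_, ∅, ∅, .empty, .empty, rfl⟩ ?_
  rintro _ ⟨S, T, hS, hT, rfl⟩
  exact h S T hS hT

theorem abs_setIntegral_le_cutNorm (hU : Integrable (fun p : Ω × Ω => U p.1 p.2) (μ.prod μ))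
    {S T : Set Ω} (hS : MeasurableSet S) (hT : MeasurableSet T) :
    |∫ p in S ×ˢ T, U p.1 p.2 ∂(μ.prod μ)| ≤ cutNorm μ U := by
  refine le_csSup ⟨∫ p, |U p.1 p.2| ∂(μ.prod μ), ?_⟩ ⟨S, T, hS, hT, rfl⟩
  rintro _ ⟨S, T, -, -, rfl⟩
  exact abs_setIntegral_le_integral_abs hU _

/-- The cut norm controls the integral against a step function. -/
theorem abs_integral_mul_step_le {ι : Type*} [Fintype ι] {c : Ω → ι}
    (hc : ∀ i, MeasurableSet (c ⁻¹' {i})) (H : ι → ι → ℝ)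
    (hU : Integrable (fun p : Ω × Ω => U p.1 p.2) (μ.prod μ)) :
    |∫ p, U p.1 p.2 * H (c p.1) (c p.2) ∂(μ.prod μ)| ≤
      (∑ i, ∑ j, |H i j|) * cutNorm μ U := by
  rw [← setIntegral_univ, ← Set.univ_prod_univ, setIntegral_mul_step_eq_sum μ hc H hU,
    Finset.sum_mul]
  refine (Finset.abs_sum_le_sum_abs _ _).trans (Finset.sum_le_sum fun i _ => ?_)
  rw [Finset.sum_mul]
  refine (Finset.abs_sum_le_sum_abs _ _).trans (Finset.sum_le_sum fun j _ => ?_)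
  rw [abs_mul]
  exact mul_le_mul_of_nonneg_left (abs_setIntegral_le_cutNorm hU ((hc i).inter .univ)
    ((hc j).inter .univ)) (abs_nonneg _)

end CutNorm

namespace Graphon

variable {Ω : Type u} [MeasurableSpace Ω]

/-- The pull-back `W^φ(x, y) = W(φ x, φ y)` of a graphon along a measurable map. -/
def comap (W : Graphon Ω) {Ω' : Type v} [MeasurableSpace Ω'] (φ : Ω' → Ω) (hφ : Measurable φ) :
    Graphon Ω' where
  toFun x y := W (φ x) (φ y)
  measurable' := W.measurable'.comp ((hφ.comp measurable_fst).prodMk (hφ.comp measurable_snd))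
  symm' _ _ := W.symm' _ _
  mem_Icc' _ _ := W.mem_Icc' _ _

theorem measurable_apply (W : Graphon Ω) : Measurable fun p : Ω × Ω => W p.1 p.2 := W.measurable'

theorem integrable (W : Graphon Ω) (m : Measure (Ω × Ω)) [IsFiniteMeasure m] :
    Integrable (fun p => W p.1 p.2) m :=
  Integrable.of_mem_Icc 0 1 W.measurable'.aemeasurable (.of_forall fun _ => W.mem_Icc' _ _)

end Graphon

section CutDist

variable {Ω₁ : Type u} {Ω₂ : Type v} [MeasurableSpace Ω₁] [MeasurableSpace Ω₂]
  {μ₁ : Measure Ω₁} {μ₂ : Measure Ω₂} {W₁ : Graphon Ω₁} {W₂ : Graphon Ω₂}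

theorem cutDist_nonneg : 0 ≤ cutDist μ₁ W₁ μ₂ W₂ := by
  refine Real.sInf_nonneg ?_
  rintro _ ⟨Ω, _, μ, φ₁, φ₂, -, -, -, rfl⟩
  exact cutNorm_nonneg

theorem cutDist_le {Ω : Type (max u v)} [MeasurableSpace Ω] (μ : Measure Ω) [IsProbabilityMeasure μ]
    {φ₁ : Ω → Ω₁} {φ₂ : Ω → Ω₂} (h₁ : MeasurePreserving φ₁ μ μ₁) (h₂ : MeasurePreserving φ₂ μ μ₂) :
    cutDist μ₁ W₁ μ₂ W₂ ≤ cutNorm μ fun x y => W₁ (φ₁ x) (φ₁ y) - W₂ (φ₂ x) (φ₂ y) := by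
  refine csInf_le ⟨0, ?_⟩ ⟨Ω, _, μ, φ₁, φ₂, ‹_›, h₁, h₂, rfl⟩
  rintro _ ⟨Ω, _, μ, φ₁, φ₂, -, -, -, rfl⟩
  exact cutNorm_nonneg

theorem exists_coupling_of_cutDist_lt [IsProbabilityMeasure μ₁] [IsProbabilityMeasure μ₂] {r : ℝ}
    (h : cutDist μ₁ W₁ μ₂ W₂ < r) :
    ∃ (Ω : Type (max u v)) (_ : MeasurableSpace Ω) (μ : Measure Ω) (φ₁ : Ω → Ω₁) (φ₂ : Ω → Ω₂),
      IsProbabilityMeasure μ ∧ MeasurePreserving φ₁ μ μ₁ ∧ MeasurePreserving φ₂ μ μ₂ ∧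
        cutNorm μ (fun x y => W₁ (φ₁ x) (φ₁ y) - W₂ (φ₂ x) (φ₂ y)) < r := by
  -- the product coupling shows that the infimum is over a non-empty set
  obtain ⟨_, ⟨Ω, _, μ, φ₁, φ₂, hμ, h₁, h₂, rfl⟩, hr⟩ := exists_lt_of_csInf_lt
    (by exact ⟨_, Ω₁ × Ω₂, _, μ₁.prod μ₂, Prod.fst, Prod.snd, inferInstance,
      measurePreserving_fst, measurePreserving_snd, rfl⟩) h
  exact ⟨Ω, _, μ, φ₁, φ₂, hμ, h₁, h₂, hr⟩

theorem abs_integral_sub_le_cutDist [IsProbabilityMeasure μ₁] [IsProbabilityMeasure μ₂] :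
    |∫ p, W₁ p.1 p.2 ∂(μ₁.prod μ₁) - ∫ p, W₂ p.1 p.2 ∂(μ₂.prod μ₂)| ≤ cutDist μ₁ W₁ μ₂ W₂ := by
  refine le_of_forall_gt fun r hr => ?_
  obtain ⟨Ω, _, μ, φ₁, φ₂, hμ, h₁, h₂, hlt⟩ := exists_coupling_of_cutDist_lt hr
  refine lt_of_le_of_lt ?_ hlt
  have hi₁ : Integrable (fun p : Ω × Ω => W₁ (φ₁ p.1) (φ₁ p.2)) (μ.prod μ) :=
    (W₁.comap φ₁ h₁.measurable).integrable _
  have hi₂ : Integrable (fun p : Ω × Ω => W₂ (φ₂ p.1) (φ₂ p.2)) (μ.prod μ) :=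
    (W₂.comap φ₂ h₂.measurable).integrable _
  have h := abs_setIntegral_le_cutNorm (hi₁.sub hi₂) (U := fun x y => W₁ (φ₁ x) (φ₁ y) -
    W₂ (φ₂ x) (φ₂ y)) MeasurableSet.univ MeasurableSet.univ
  rw [Set.univ_prod_univ, setIntegral_univ] at h
  rw [← h₁.integral_comp_prod W₁.measurable_apply,
    ← h₂.integral_comp_prod W₂.measurable_apply, ← integral_sub hi₁ hi₂]
  exact h

end CutDist

/-! ### A quasi-random pairing on `(ZMod q)²` -/

section QuasiRandom

variable (q : ℕ)

/-- The symmetric map `(a, b) ↦ a₁ b₁ + a₂ + b₂` on `(ZMod q)²`. As functions of a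
uniform `a`, its values at `b` and `b'` are independent and uniform if `b₁ ≠ b'₁`, see
`bijective_affinePairing_pair`. -/
def affinePairing (a b : ZMod q × ZMod q) : ZMod q := a.1 * b.1 + a.2 + b.2

theorem affinePairing_comm (a b : ZMod q × ZMod q) :
    affinePairing q a b = affinePairing q b a := by
  simp only [affinePairing]; ring

variable [Fact q.Prime]

theorem bijective_affinePairing_pair {b b' : ZMod q × ZMod q} (h : b.1 ≠ b'.1) :
    Function.Bijective fun a => (affinePairing q a b, affinePairing q a b') := by
  rw [← Finite.injective_iff_bijective]
  intro x y hxy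
  simp only [affinePairing, Prod.mk.injEq] at hxy
  obtain ⟨h1, h2⟩ := hxy
  have h3 : (x.1 - y.1) * (b.1 - b'.1) = 0 := by linear_combination h1 - h2
  have h4 : x.1 = y.1 := by
    rcases mul_eq_zero.1 h3 with h | h'
    · exact sub_eq_zero.1 h
    · exact absurd (sub_eq_zero.1 h') h
  refine Prod.ext h4 ?_
  rw [h4] at h1
  linear_combination h1

variable {q}

theorem sum_affinePairing_mul {d : ZMod q → ℝ} (hd : ∑ u, d u = 0) {b b' : ZMod q × ZMod q}
    (h : b.1 ≠ b'.1) : ∑ a, d (affinePairing q a b) * d (affinePairing q a b') = 0 := by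
  rw [(bijective_affinePairing_pair q h).sum_comp fun p : ZMod q × ZMod q => d p.1 * d p.2,
    Fintype.sum_prod_type, ← Finset.sum_mul_sum, hd, zero_mul]

/-- The second moment bound: by the Cauchy–Schwarz inequality in `a`, only the `q³` pairs `(b, b')`
with `b₁ = b'₁` contribute. -/
theorem sq_sum_affinePairing_le {d : ZMod q → ℝ} (hd : ∑ u, d u = 0) (hd' : ∀ u, |d u| ≤ 1)
    {s t : ZMod q × ZMod q → ℝ} (hs : ∀ a, |s a| ≤ 1) (ht : ∀ a, |t a| ≤ 1) :
    (∑ a, ∑ b, d (affinePairing q a b) * (s a * t b)) ^ 2 ≤ (q : ℝ) ^ 7 := by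
  have hcard : (Fintype.card (ZMod q × ZMod q) : ℝ) = (q : ℝ) ^ 2 := by
    simp [ZMod.card, sq]
  set D : ZMod q × ZMod q → ZMod q × ZMod q → ℝ := fun a b => d (affinePairing q a b)
  have hab : ∀ x y : ℝ, |x| ≤ 1 → |y| ≤ 1 → |x * y| ≤ 1 := fun x y hx hy => by
    rw [abs_mul]; exact mul_le_one₀ hx (abs_nonneg _) hy
  have hcs : (∑ a, ∑ b, D a b * (s a * t b)) ^ 2 ≤
      (∑ a, s a ^ 2) * ∑ a, (∑ b, D a b * t b) ^ 2 := by
    refine le_trans (le_of_eq ?_) (Finset.sum_mul_sq_le_sq_mul_sq Finset.univ s _)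
    congr 1
    refine Finset.sum_congr rfl fun a _ => ?_
    rw [Finset.mul_sum]
    exact Finset.sum_congr rfl fun b _ => by ring
  have hs2 : ∑ a, s a ^ 2 ≤ (q : ℝ) ^ 2 := by
    rw [← hcard, ← Finset.card_univ, ← nsmul_one, ← Finset.sum_const]
    exact Finset.sum_le_sum fun a _ => (sq_le_one_iff_abs_le_one _).2 (hs a)
  have hexp : ∑ a, (∑ b, D a b * t b) ^ 2 =
      ∑ b, ∑ b', (t b * t b') * ∑ a, D a b * D a b' := by
    simp_rw [sq, Finset.sum_mul_sum, Finset.mul_sum]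
    rw [Finset.sum_comm]
    refine Finset.sum_congr rfl fun b _ => ?_
    rw [Finset.sum_comm]
    exact Finset.sum_congr rfl fun b' _ => Finset.sum_congr rfl fun a _ => by ring
  have hpair : ∀ b b' : ZMod q × ZMod q, (t b * t b') * ∑ a, D a b * D a b' ≤
      if b.1 = b'.1 then (q : ℝ) ^ 2 else 0 := by
    intro b b'
    split_ifs with h
    · rw [← hcard, ← Finset.card_univ, ← nsmul_one, ← Finset.sum_const, Finset.mul_sum]
      exact Finset.sum_le_sum fun a _ => (le_abs_self _).trans
        (hab _ _ (hab _ _ (ht b) (ht b')) (hab _ _ (hd' _) (hd' _)))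
    · rw [sum_affinePairing_mul hd h, mul_zero]
  have hcount : ∑ b : ZMod q × ZMod q, ∑ b' : ZMod q × ZMod q,
      (if b.1 = b'.1 then (q : ℝ) ^ 2 else 0) = (q : ℝ) ^ 5 := by
    simp_rw [Fintype.sum_prod_type]
    change ∑ x : ZMod q, ∑ _ : ZMod q, ∑ x' : ZMod q, ∑ _ : ZMod q,
      (if x = x' then (q : ℝ) ^ 2 else 0) = _
    simp only [Finset.sum_const, Finset.card_univ, ZMod.card, nsmul_eq_mul,
      mul_ite, mul_zero, Finset.sum_ite_eq, Finset.mem_univ, if_true]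
    ring
  calc _ ≤ (∑ a, s a ^ 2) * ∑ a, (∑ b, D a b * t b) ^ 2 := hcs
    _ ≤ (q : ℝ) ^ 2 * (q : ℝ) ^ 5 := by
        refine mul_le_mul hs2 ?_ (Finset.sum_nonneg fun a _ => sq_nonneg _) (by positivity)
        rw [hexp, ← hcount]
        exact Finset.sum_le_sum fun b _ => Finset.sum_le_sum fun b' _ => hpair b b'
    _ = (q : ℝ) ^ 7 := by ring

theorem abs_sum_affinePairing_le {d : ZMod q → ℝ} (hd : ∑ u, d u = 0) (hd' : ∀ u, |d u| ≤ 1)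
    {s t : ZMod q × ZMod q → ℝ} (hs : ∀ a, |s a| ≤ 1 / (q : ℝ) ^ 2)
    (ht : ∀ a, |t a| ≤ 1 / (q : ℝ) ^ 2) :
    |∑ a, ∑ b, d (affinePairing q a b) * (s a * t b)| ≤ 1 / √q := by
  have hq : (0 : ℝ) < q := by exact_mod_cast (Fact.out : q.Prime).pos
  have hsc : ∀ x : ℝ, |x| ≤ 1 / (q : ℝ) ^ 2 → |(q : ℝ) ^ 2 * x| ≤ 1 := fun x hx => by
    rw [abs_mul, abs_of_pos (by positivity), mul_comm]
    exact (le_div_iff₀ (by positivity)).1 hx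
  have h := sq_sum_affinePairing_le hd hd' (fun a => hsc _ (hs a)) (fun a => hsc _ (ht a))
  have e : ∑ a, ∑ b, d (affinePairing q a b) * ((q : ℝ) ^ 2 * s a * ((q : ℝ) ^ 2 * t b)) =
      (q : ℝ) ^ 4 * ∑ a, ∑ b, d (affinePairing q a b) * (s a * t b) := by
    simp_rw [Finset.mul_sum]
    exact Finset.sum_congr rfl fun a _ => Finset.sum_congr rfl fun b _ => by ring
  rw [e, mul_pow] at h
  refine abs_le_of_sq_le_sq ?_ (by positivity)
  rw [div_pow, Real.sq_sqrt hq.le, one_pow, le_div_iff₀ hq]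
  have : (q : ℝ) ^ 7 * ((∑ a, ∑ b, d (affinePairing q a b) * (s a * t b)) ^ 2 * q) ≤
      (q : ℝ) ^ 7 * 1 := by linarith
  exact le_of_mul_le_mul_left this (by positivity)

end QuasiRandom

/-- If every fibre of `κ` has measure at most `1 / q²`, a function built from mean-zero functions of
the affine pairing has small cut norm when pulled back along `κ`. -/
theorem abs_setIntegral_step_le {Ω : Type u} [MeasurableSpace Ω] (μ : Measure Ω)
    [IsProbabilityMeasure μ] {ι : Type*} [Fintype ι] {q : ℕ} [Fact q.Prime]
    {κ : Ω → ι × (ZMod q × ZMod q)} (hκ : ∀ y, MeasurableSet (κ ⁻¹' {y}))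
    (hκμ : ∀ y, μ.real (κ ⁻¹' {y}) ≤ 1 / (q : ℝ) ^ 2)
    {d : ι → ι → ZMod q → ℝ} (hd : ∀ i j, ∑ u, d i j u = 0) (hd' : ∀ i j u, |d i j u| ≤ 1)
    (S T : Set Ω) :
    |∫ p in S ×ˢ T, d (κ p.1).1 (κ p.2).1 (affinePairing q (κ p.1).2 (κ p.2).2) ∂(μ.prod μ)| ≤
      (Fintype.card ι : ℝ) ^ 2 / √q := by
  have h := setIntegral_mul_step_eq_sum μ hκ (fun y z => d y.1 z.1 (affinePairing q y.2 z.2))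
    (integrable_const (1 : ℝ)) S T
  simp only [one_mul, setIntegral_const, smul_eq_mul, mul_one, measureReal_prod_prod] at h
  have e : ∑ y : ι × (ZMod q × ZMod q), ∑ z : ι × (ZMod q × ZMod q),
        d y.1 z.1 (affinePairing q y.2 z.2) *
          (μ.real (κ ⁻¹' {y} ∩ S) * μ.real (κ ⁻¹' {z} ∩ T)) =
      ∑ i, ∑ j, ∑ a, ∑ b, d i j (affinePairing q a b) *
          (μ.real (κ ⁻¹' {(i, a)} ∩ S) * μ.real (κ ⁻¹' {(j, b)} ∩ T)) := by
    rw [Fintype.sum_prod_type]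
    refine Finset.sum_congr rfl fun i _ => ?_
    simp_rw [Fintype.sum_prod_type (α₁ := ι)]
    rw [Finset.sum_comm]
  have hw : ∀ (R : Set Ω) y, |μ.real (κ ⁻¹' {y} ∩ R)| ≤ 1 / (q : ℝ) ^ 2 := fun R y => by
    rw [abs_of_nonneg measureReal_nonneg]
    exact (measureReal_mono Set.inter_subset_left).trans (hκμ y)
  rw [h, e]
  calc _ ≤ ∑ i : ι, ∑ j : ι, 1 / √q :=
        (Finset.abs_sum_le_sum_abs _ _).trans <| Finset.sum_le_sum fun i _ =>
          (Finset.abs_sum_le_sum_abs _ _).trans <| Finset.sum_le_sum fun j _ =>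
            abs_sum_affinePairing_le (hd i j) (hd' i j) (fun a => hw S (i, a)) fun b => hw T (j, b)
    _ = _ := by
        simp only [Finset.sum_const, Finset.card_univ, nsmul_eq_mul]
        ring

/-! ### Approximation by graphons with values in `{0, 1}` -/

theorem exists_prime_div_sqrt_le (C : ℝ) {ε : ℝ} (hε : 0 < ε) :
    ∃ q : ℕ, q.Prime ∧ C / √q ≤ ε ∧ 1 / (q : ℝ) ≤ ε := by
  have h1 : Tendsto (fun q : ℕ => C / √(q : ℝ)) atTop (𝓝 0) :=
    (Real.tendsto_sqrt_atTop.comp tendsto_natCast_atTop_atTop).const_div_atTop C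
  have h2 : Tendsto (fun q : ℕ => 1 / (q : ℝ)) atTop (𝓝 0) :=
    tendsto_natCast_atTop_atTop.const_div_atTop 1
  obtain ⟨N, hN⟩ := eventually_atTop.1
    ((h1.eventually_le_const hε).and (h2.eventually_le_const hε))
  obtain ⟨q, hq, hp⟩ := Nat.exists_infinite_primes N
  exact ⟨q, hp, hN q hq⟩

/-- The graphon on `ι × (ZMod q × ZMod q)` with values in `{0, 1}` for which `(i, a)` and `(j, b)`
are adjacent if the affine pairing of `a` and `b` lies in the set `R i j`. -/
noncomputable def affineGraphon {q : ℕ} [Fact q.Prime] {ι : Type*} [Finite ι]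
    [MeasurableSpace (ι × (ZMod q × ZMod q))] [DiscreteMeasurableSpace (ι × (ZMod q × ZMod q))]
    (R : ι → ι → Finset (ZMod q)) (hR : ∀ i j, R i j = R j i) :
    Graphon (ι × (ZMod q × ZMod q)) where
  toFun y z := if affinePairing q y.2 z.2 ∈ R y.1 z.1 then 1 else 0
  measurable' := .of_discrete
  symm' y z := by rw [affinePairing_comm, hR]
  mem_Icc' y z := by split_ifs <;> simp

/-- The three errors made in replacing `W` by an affine graphon: the deviation of the pairing from
its mean, the rounding of the densities to multiples of `1 / q`, and the `L¹` distance of `W` to the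
step function with values `H`. The map `c ∘ ψ` provides the index of the step, and `σ` the random
point of `(ZMod q)²`. -/
theorem cutNorm_affineGraphon_sub_le {Ω : Type u} [MeasurableSpace Ω] {μ : Measure Ω}
    [IsProbabilityMeasure μ] {W : Graphon Ω} {q : ℕ} [Fact q.Prime] {ι : Type} [Fintype ι]
    [MeasurableSpace ι] [DiscreteMeasurableSpace ι] {R : ι → ι → Finset (ZMod q)}
    (hR : ∀ i j, R i j = R j i) {H : ι → ι → ℝ}
    (hRH : ∀ i j, |(R i j).card / (q : ℝ) - H i j| ≤ 1 / q)
    {c : Ω → ι} (hc : Measurable c) {δ : ℝ}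
    (hWH : ∫ p, |W p.1 p.2 - H (c p.1) (c p.2)| ∂(μ.prod μ) ≤ δ)
    {Ω' : Type v} [MeasurableSpace Ω'] {m : Measure Ω'} [IsProbabilityMeasure m]
    {ψ : Ω' → Ω} (hψ : MeasurePreserving ψ m μ) {σ : Ω' → ZMod q × ZMod q} (hσ : Measurable σ)
    (hm : ∀ i a, m.real (ψ ⁻¹' (c ⁻¹' {i}) ∩ σ ⁻¹' {a}) ≤ 1 / (q : ℝ) ^ 2) :
    cutNorm m (fun x y => affineGraphon R hR (c (ψ x), σ x) (c (ψ y), σ y) - W (ψ x) (ψ y)) ≤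
      (Fintype.card ι : ℝ) ^ 2 / √q + (1 / q + δ) := by
  have hq0 : (0 : ℝ) < q := by exact_mod_cast (Fact.out : q.Prime).pos
  set κ : Ω' → ι × (ZMod q × ZMod q) := fun x => (c (ψ x), σ x)
  have hκ : Measurable κ := (hc.comp hψ.measurable).prodMk hσ
  set d : ι → ι → ZMod q → ℝ := fun i j u =>
    (if u ∈ R i j then 1 else 0) - (R i j).card / (q : ℝ) with hd
  have hd0 : ∀ i j, ∑ u, d i j u = 0 := fun i j => by
    simp only [hd, Finset.sum_sub_distrib, Finset.sum_ite_mem, Finset.univ_inter, Finset.sum_const,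
      Finset.card_univ, ZMod.card, nsmul_eq_mul]
    field_simp
    simp
  have hd1 : ∀ i j u, |d i j u| ≤ 1 := fun i j u => by
    have h1 : ((R i j).card : ℝ) / q ≤ 1 := (div_le_one hq0).2
      (by exact_mod_cast (Finset.card_le_univ _).trans_eq (ZMod.card q))
    have h2 : 0 ≤ ((R i j).card : ℝ) / q := by positivity
    simp only [hd]
    rw [abs_le]
    split_ifs <;> constructor <;> linarith
  have hκm : ∀ y, m.real (κ ⁻¹' {y}) ≤ 1 / (q : ℝ) ^ 2 := fun y => by
    refine le_of_eq_of_le ?_ (hm y.1 y.2)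
    congr 1
    ext x
    simp [κ, Prod.ext_iff]
  have hstep : ∀ f : ι × (ZMod q × ZMod q) → ι × (ZMod q × ZMod q) → ℝ,
      Integrable (fun p : Ω' × Ω' => f (κ p.1) (κ p.2)) (m.prod m) := fun f =>
    IsStepFun.integrable ⟨_, inferInstance, κ, f, fun y => hκ (measurableSet_singleton y),
      fun _ => rfl⟩ _
  have hW : Integrable (fun p : Ω' × Ω' => W (ψ p.1) (ψ p.2)) (m.prod m) :=
    (W.comap ψ hψ.measurable).integrable _
  have hHm : Measurable fun p : Ω × Ω => H (c p.1) (c p.2) :=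
    IsStepFun.measurable ⟨ι, inferInstance, c, H, fun i => hc (measurableSet_singleton i),
      fun _ => rfl⟩
  have hi₁ := hstep fun y z => d y.1 z.1 (affinePairing q y.2 z.2)
  have hi₂ : Integrable (fun p : Ω' × Ω' =>
      (R (κ p.1).1 (κ p.2).1).card / (q : ℝ) - W (ψ p.1) (ψ p.2)) (m.prod m) :=
    (hstep fun y z => (R y.1 z.1).card / (q : ℝ)).sub hW
  refine cutNorm_le fun S T _ _ => ?_
  have hsplit : ∫ p in S ×ˢ T,
        (affineGraphon R hR (κ p.1) (κ p.2) - W (ψ p.1) (ψ p.2)) ∂(m.prod m) =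
      ∫ p in S ×ˢ T, d (κ p.1).1 (κ p.2).1 (affinePairing q (κ p.1).2 (κ p.2).2) ∂(m.prod m) +
      ∫ p in S ×ˢ T, ((R (κ p.1).1 (κ p.2).1).card / (q : ℝ) - W (ψ p.1) (ψ p.2)) ∂(m.prod m) := by
    rw [← integral_add hi₁.restrict hi₂.restrict]
    refine integral_congr_ae (.of_forall fun p => ?_)
    simp only [affineGraphon, hd]
    ring
  have hL1 : ∫ p, |(R (κ p.1).1 (κ p.2).1).card / (q : ℝ) - W (ψ p.1) (ψ p.2)| ∂(m.prod m) ≤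
      1 / q + δ := by
    have hpull : ∫ p, |W (ψ p.1) (ψ p.2) - H (c (ψ p.1)) (c (ψ p.2))| ∂(m.prod m) =
        ∫ p, |W p.1 p.2 - H (c p.1) (c p.2)| ∂(μ.prod μ) :=
      hψ.integral_comp_prod (f := fun x y => |W x y - H (c x) (c y)|)
        (W.measurable_apply.sub hHm).abs
    have hi : Integrable (fun p : Ω' × Ω' => |W (ψ p.1) (ψ p.2) - H (c (ψ p.1)) (c (ψ p.2))|)
        (m.prod m) := (hW.sub (hstep fun y z => H y.1 z.1)).abs
    calc _ ≤ ∫ p : Ω' × Ω', (1 / (q : ℝ) + |W (ψ p.1) (ψ p.2) - H (c (ψ p.1)) (c (ψ p.2))|)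
          ∂(m.prod m) := by
          refine integral_mono hi₂.abs ((integrable_const _).add hi) fun p => ?_
          refine (abs_sub_le _ (H (c (ψ p.1)) (c (ψ p.2))) _).trans (add_le_add (hRH _ _) ?_)
          rw [abs_sub_comm]
      _ = 1 / q + ∫ p, |W p.1 p.2 - H (c p.1) (c p.2)| ∂(μ.prod μ) := by
          rw [integral_add (integrable_const _) hi, hpull]
          simp
      _ ≤ 1 / q + δ := by gcongr
  rw [hsplit]
  exact (abs_add_le _ _).trans (add_le_add
    (abs_setIntegral_step_le m (fun y => hκ (measurableSet_singleton y)) hκm hd0 hd1 S T)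
    ((abs_setIntegral_le_integral_abs hi₂ _).trans hL1))

/-- Graphons with values in `{0, 1}` on spaces of any prescribed universe are dense in the cut
metric. -/
theorem exists_zero_one_graphon_cutDist_le {Ω : Type u} [MeasurableSpace Ω] (μ : Measure Ω)
    [IsProbabilityMeasure μ] (W : Graphon Ω) {ε : ℝ} (hε : 0 < ε) :
    ∃ (Y : Type v) (_ : MeasurableSpace Y) (ν : Measure Y) (_ : IsProbabilityMeasure ν)
      (G : Graphon Y), (∀ x y, G x y = 0 ∨ G x y = 1) ∧ cutDist ν G μ W ≤ ε := by
  obtain ⟨ι, _, c, H, hc, hHsymm, hH, hWH⟩ := W.exists_step_approx μ (ε := ε / 3) (by positivity)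
  obtain ⟨q, hq, hq1, hq2⟩ := exists_prime_div_sqrt_le ((Fintype.card ι : ℝ) ^ 2)
    (ε := ε / 3) (by positivity)
  have : Fact q.Prime := ⟨hq⟩
  have hq0 : (0 : ℝ) < q := by exact_mod_cast hq.pos
  let _ : MeasurableSpace ι := ⊤
  have : DiscreteMeasurableSpace ι := ⟨fun _ => trivial⟩
  have hcm : Measurable c := measurable_to_countable' hc
  have hex : ∀ n : ℕ, ∃ R : Finset (ZMod q), n ≤ q → R.card = n := fun n => by
    by_cases hn : n ≤ q
    · obtain ⟨R, -, hR⟩ := Finset.exists_subset_card_eq (s := (Finset.univ : Finset (ZMod q)))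
        (n := n) (by rwa [Finset.card_univ, ZMod.card])
      exact ⟨R, fun _ => hR⟩
    · exact ⟨∅, fun h => absurd h hn⟩
  choose R hR using hex
  -- the densities `H i j` are rounded down to multiples of `1 / q`
  have hRH : ∀ i j, |(R ⌊q * H i j⌋₊).card / (q : ℝ) - H i j| ≤ 1 / q := fun i j => by
    have h1 := Nat.floor_le (mul_nonneg hq0.le (hH i j).1)
    have h2 := Nat.lt_floor_add_one ((q : ℝ) * H i j)
    rw [hR _ (Nat.floor_le_of_le (by nlinarith [(hH i j).2])),
      show ⌊q * H i j⌋₊ / (q : ℝ) - H i j = (⌊q * H i j⌋₊ - q * H i j) / q by field_simp, abs_div,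
      abs_of_pos hq0]
    gcongr
    rw [abs_le]
    constructor <;> linarith
  -- the common probability space of the coupling is a copy of `Ω × (ZMod q × ZMod q)`
  let unif : Measure (ZMod q × ZMod q) := ProbabilityTheory.uniformOn Set.univ
  have hunif : IsProbabilityMeasure unif :=
    ProbabilityTheory.isProbabilityMeasure_uniformOn Set.finite_univ Set.univ_nonempty
  have hunif' : ∀ a, unif.real {a} = 1 / (q : ℝ) ^ 2 := fun a => by
    simp [unif, Measure.real, ProbabilityTheory.uniformOn_univ, ZMod.card, sq]
  let m : Measure (ULift.{v} (Ω × (ZMod q × ZMod q))) := (μ.prod unif).map ULift.up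
  have hdown : MeasurePreserving (ULift.down : ULift.{v} (Ω × (ZMod q × ZMod q)) → _)
      m (μ.prod unif) := by
    refine ⟨measurable_down, ?_⟩
    rw [Measure.map_map measurable_down measurable_up]
    exact Measure.map_id
  have hm : IsProbabilityMeasure m := Measure.isProbabilityMeasure_map measurable_up.aemeasurable
  have hψ : MeasurePreserving (fun z : ULift.{v} (Ω × (ZMod q × ZMod q)) => z.down.1) m μ :=
    measurePreserving_fst.comp hdown
  have hσ : MeasurePreserving (fun z : ULift.{v} (Ω × (ZMod q × ZMod q)) => z.down.2) m unif :=
    measurePreserving_snd.comp hdown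
  let κ : ULift.{v} (Ω × (ZMod q × ZMod q)) → ULift.{v} (ι × (ZMod q × ZMod q)) :=
    fun z => ULift.up (c z.down.1, z.down.2)
  have hκ : Measurable κ :=
    measurable_up.comp ((hcm.comp hψ.measurable).prodMk hσ.measurable)
  have hRsymm : ∀ i j, R ⌊q * H i j⌋₊ = R ⌊q * H j i⌋₊ := fun i j => by rw [hHsymm]
  refine ⟨ULift.{v} (ι × (ZMod q × ZMod q)), inferInstance, m.map κ,
    Measure.isProbabilityMeasure_map hκ.aemeasurable,
    (affineGraphon _ hRsymm).comap ULift.down measurable_down, fun x y => ?_, ?_⟩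
  · simp only [Graphon.comap, affineGraphon]
    split_ifs <;> simp
  have hm : ∀ i a,
      m.real ((fun z : ULift.{v} (Ω × (ZMod q × ZMod q)) => z.down.1) ⁻¹' (c ⁻¹' {i}) ∩
      (fun z : ULift.{v} (Ω × (ZMod q × ZMod q)) => z.down.2) ⁻¹' {a}) ≤ 1 / (q : ℝ) ^ 2 := by
    intro i a
    rw [← hunif' a, ← hσ.measureReal_preimage (measurableSet_singleton a).nullMeasurableSet]
    exact measureReal_mono Set.inter_subset_right
  refine (cutDist_le m ⟨hκ, rfl⟩ hψ).trans
    ((cutNorm_affineGraphon_sub_le hRsymm hRH hcm hWH hψ hσ.measurable hm).trans ?_)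
  linarith

/-! ### Homomorphism densities -/

theorem measurePreserving_eval_pair {ι : Type*} [Fintype ι] {Ω : Type u} [MeasurableSpace Ω]
    (μ : Measure Ω) [IsProbabilityMeasure μ] {i j : ι} (hij : i ≠ j) :
    MeasurePreserving (fun x : ι → Ω => (x i, x j)) (Measure.pi fun _ => μ) (μ.prod μ) := by
  refine ⟨(measurable_pi_apply i).prodMk (measurable_pi_apply j), ?_⟩
  have h := ProbabilityTheory.iIndepFun_pi (μ := fun _ : ι => μ) (X := fun _ : ι => (id : Ω → Ω))
    fun _ => aemeasurable_id
  have h2 := (ProbabilityTheory.indepFun_iff_map_prod_eq_prod_map_map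
    (measurable_pi_apply i).aemeasurable (measurable_pi_apply j).aemeasurable).1 (h.indepFun hij)
  rw [(measurePreserving_eval (fun _ : ι => μ) i).map_eq,
    (measurePreserving_eval (fun _ : ι => μ) j).map_eq] at h2
  exact h2

theorem abs_prod_sub_prod_le {κ : Type*} (s : Finset κ) {a b : κ → ℝ}
    (ha : ∀ i, a i ∈ Set.Icc (0 : ℝ) 1) (hb : ∀ i, b i ∈ Set.Icc (0 : ℝ) 1) :
    |∏ i ∈ s, a i - ∏ i ∈ s, b i| ≤ ∑ i ∈ s, |a i - b i| := by
  classical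
  induction s using Finset.induction_on with
  | empty => simp
  | insert i s hi ih =>
    rw [Finset.prod_insert hi, Finset.prod_insert hi, Finset.sum_insert hi,
      show a i * ∏ j ∈ s, a j - b i * ∏ j ∈ s, b j =
        (a i - b i) * ∏ j ∈ s, a j + b i * (∏ j ∈ s, a j - ∏ j ∈ s, b j) by ring]
    refine (abs_add_le _ _).trans (add_le_add ?_ (le_trans ?_ ih))
    · rw [abs_mul, Finset.abs_prod]
      exact mul_le_of_le_one_right (abs_nonneg _) (Finset.prod_le_one (fun _ _ => abs_nonneg _)
        fun j _ => abs_le.2 ⟨by linarith [(ha j).1], (ha j).2⟩)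
    · rw [abs_mul, abs_of_nonneg (hb i).1]
      exact mul_le_of_le_one_left (abs_nonneg _) (hb i).2

namespace Graphon

section HomDensity

variable {V : Type v} {E : Type w} (F : Graph V E)

theorem edgeFactor_mem_Icc {Ω : Type u} [MeasurableSpace Ω] (W : Graphon Ω) (x : F.vertexSet → Ω)
    (e : F.edgeSet) : W.edgeFactor F x e ∈ Set.Icc (0 : ℝ) 1 :=
  W.mem_Icc' _ _

theorem measurable_edgeFactor {Ω : Type u} [MeasurableSpace Ω] (W : Graphon Ω) (e : F.edgeSet) :
    Measurable fun x => W.edgeFactor F x e := by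
  obtain ⟨i, j, h⟩ := F.exists_isLink_of_mem_edgeSet e.2
  simp only [fun x => W.edgeFactor_eq F x e ⟨i, h.left_mem⟩ ⟨j, h.right_mem⟩ h]
  have hp : Measurable fun x : F.vertexSet → Ω => (x ⟨i, h.left_mem⟩, x ⟨j, h.right_mem⟩) :=
    (measurable_pi_apply _).prodMk (measurable_pi_apply _)
  exact W.measurable_apply.comp hp

theorem exists_edgeFactor_eq [F.Loopless] (e : F.edgeSet) : ∃ i j : F.vertexSet, i ≠ j ∧
    ∀ {Ω : Type u} [MeasurableSpace Ω] (W : Graphon Ω) (x : F.vertexSet → Ω),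
      W.edgeFactor F x e = W (x i) (x j) := by
  obtain ⟨i, j, h⟩ := F.exists_isLink_of_mem_edgeSet e.2
  exact ⟨⟨i, h.left_mem⟩, ⟨j, h.right_mem⟩, fun hij => h.ne (congrArg Subtype.val hij),
    fun W x => W.edgeFactor_eq F x e _ _ h⟩

variable [Fintype F.vertexSet] [Fintype F.edgeSet]

theorem integrable_prod_edgeFactor {Ω : Type u} [MeasurableSpace Ω] (μ : Measure Ω)
    [IsProbabilityMeasure μ] (W : Graphon Ω) :
    Integrable (fun x => ∏ e : F.edgeSet, W.edgeFactor F x e)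
      (Measure.pi fun _ : F.vertexSet => μ) :=
  Integrable.of_mem_Icc 0 1
    (Finset.measurable_prod _ fun e _ => W.measurable_edgeFactor F e).aemeasurable
    (.of_forall fun x => ⟨Finset.prod_nonneg fun e _ => (W.edgeFactor_mem_Icc F x e).1,
      Finset.prod_le_one (fun e _ => (W.edgeFactor_mem_Icc F x e).1)
        fun e _ => (W.edgeFactor_mem_Icc F x e).2⟩)

theorem homDensity_comap {Ω : Type*} {Ω' : Type*} [MeasurableSpace Ω] [MeasurableSpace Ω']
    {μ : Measure Ω} {m : Measure Ω'} [IsProbabilityMeasure μ] [IsProbabilityMeasure m]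
    (W : Graphon Ω) {φ : Ω' → Ω} (hφ : MeasurePreserving φ m μ) :
    homDensity F m (W.comap φ hφ.measurable) = homDensity F μ W := by
  have hpi := measurePreserving_pi (fun _ : F.vertexSet => m) (fun _ : F.vertexSet => μ)
    fun _ => hφ
  unfold homDensity
  rw [← hpi.map_eq, integral_map hpi.measurable.aemeasurable
    (Finset.measurable_prod _ fun e _ => W.measurable_edgeFactor F e).aestronglyMeasurable]
  rfl

/-- As `F` has no loops, the two ends of an edge are independent, so each edge contributes the `L¹`
distance of the graphons. -/
theorem abs_homDensity_sub_le [F.Loopless] {Ω : Type u} [MeasurableSpace Ω] (μ : Measure Ω)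
    [IsProbabilityMeasure μ] (W W' : Graphon Ω) :
    |homDensity F μ W - homDensity F μ W'| ≤
      Fintype.card F.edgeSet * ∫ p, |W p.1 p.2 - W' p.1 p.2| ∂(μ.prod μ) := by
  have hedge : ∀ e : F.edgeSet,
      Integrable (fun x => |W.edgeFactor F x e - W'.edgeFactor F x e|)
        (Measure.pi fun _ : F.vertexSet => μ) ∧
      ∫ x, |W.edgeFactor F x e - W'.edgeFactor F x e| ∂(Measure.pi fun _ : F.vertexSet => μ) =
        ∫ p, |W p.1 p.2 - W' p.1 p.2| ∂(μ.prod μ) := fun e => by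
    obtain ⟨i, j, hij, h⟩ := exists_edgeFactor_eq.{u} F e
    have hmp := measurePreserving_eval_pair μ hij
    have hint : Integrable (fun p : Ω × Ω => |W p.1 p.2 - W' p.1 p.2|) (μ.prod μ) :=
      ((W.integrable _).sub (W'.integrable _)).abs
    simp only [h]
    refine ⟨hmp.integrable_comp_of_integrable hint, ?_⟩
    have hm := hint.aestronglyMeasurable
    rw [← hmp.map_eq] at hm ⊢
    rw [integral_map hmp.measurable.aemeasurable hm]
  unfold homDensity
  rw [← integral_sub (W.integrable_prod_edgeFactor F μ) (W'.integrable_prod_edgeFactor F μ)]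
  calc _ ≤ ∫ x, ∑ e : F.edgeSet, |W.edgeFactor F x e - W'.edgeFactor F x e|
        ∂(Measure.pi fun _ : F.vertexSet => μ) :=
        abs_integral_le_integral_abs.trans <| integral_mono
          ((W.integrable_prod_edgeFactor F μ).sub (W'.integrable_prod_edgeFactor F μ)).abs
          (integrable_finsetSum _ fun e _ => (hedge e).1) fun x =>
            abs_prod_sub_prod_le _ (W.edgeFactor_mem_Icc F x) (W'.edgeFactor_mem_Icc F x)
    _ = _ := by
        rw [integral_finsetSum _ fun e _ => (hedge e).1]
        simp only [fun e => (hedge e).2, Finset.sum_const, Finset.card_univ, nsmul_eq_mul]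

theorem homDensity_eq_integral_pow {Ω : Type u} [MeasurableSpace Ω] (μ : Measure Ω)
    [IsProbabilityMeasure μ] (W : Graphon Ω) {i j : F.vertexSet} (hij : i ≠ j)
    (h : ∀ e : F.edgeSet, F.IsLink e i j) :
    homDensity F μ W = ∫ p, W p.1 p.2 ^ Fintype.card F.edgeSet ∂(μ.prod μ) := by
  have hmp := measurePreserving_eval_pair μ hij
  have hW : ∀ (x : F.vertexSet → Ω) (e : F.edgeSet), W.edgeFactor F x e = W (x i) (x j) :=
    fun x e => W.edgeFactor_eq F x e i j (h e)
  unfold homDensity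
  simp only [hW, Finset.prod_const, Finset.card_univ]
  rw [← hmp.map_eq, integral_map hmp.measurable.aemeasurable
    (W.measurable_apply.pow_const _).aestronglyMeasurable]

end HomDensity

/-- The density of the double edge. -/
theorem homDensity_banana {Ω : Type u} [MeasurableSpace Ω] (μ : Measure Ω)
    [IsProbabilityMeasure μ] (W : Graphon Ω)
    [Fintype (Graph.banana false true (Set.univ : Set Bool)).vertexSet]
    [Fintype (Graph.banana false true (Set.univ : Set Bool)).edgeSet] :
    homDensity (Graph.banana false true (Set.univ : Set Bool)) μ W =
      ∫ p, W p.1 p.2 ^ 2 ∂(μ.prod μ) := by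
  have hcard : Fintype.card (Graph.banana false true (Set.univ : Set Bool)).edgeSet = 2 := by
    rw [← Nat.card_eq_fintype_card]
    simp
  rw [homDensity_eq_integral_pow _ μ W (i := ⟨false, by simp⟩) (j := ⟨true, by simp⟩) (by simp)
    (by simp), hcard]

/-! ### Random-free graphons -/

theorem isRandomFree_of_integral_sq_eq {Ω : Type u} [MeasurableSpace Ω] {μ : Measure Ω}
    [IsProbabilityMeasure μ] (W : Graphon Ω)
    (h : ∫ p, W p.1 p.2 ^ 2 ∂(μ.prod μ) = ∫ p, W p.1 p.2 ∂(μ.prod μ)) : W.IsRandomFree μ := by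
  have hsq : Integrable (fun p : Ω × Ω => W p.1 p.2 ^ 2) (μ.prod μ) :=
    Integrable.of_mem_Icc 0 1 (W.measurable_apply.pow_const 2).aemeasurable
      (.of_forall fun p => ⟨sq_nonneg _, pow_le_one₀ (W.mem_Icc' _ _).1 (W.mem_Icc' _ _).2⟩)
  have h0 : ∫ p, (W p.1 p.2 - W p.1 p.2 ^ 2) ∂(μ.prod μ) = 0 := by
    rw [integral_sub (W.integrable _) hsq, h, sub_self]
  have hnn : 0 ≤ fun p : Ω × Ω => W p.1 p.2 - W p.1 p.2 ^ 2 := fun p => by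
    have := W.mem_Icc' p.1 p.2
    simp only [Pi.zero_apply, Set.mem_Icc] at this ⊢
    nlinarith
  have hae := (integral_eq_zero_iff_of_nonneg hnn ((W.integrable _).sub hsq)).1 h0
  filter_upwards [hae] with p hp
  have : W p.1 p.2 * (1 - W p.1 p.2) = 0 := by
    simp only [Pi.zero_apply] at hp
    linear_combination hp
  rcases mul_eq_zero.1 this with h | h
  · exact .inl h
  · exact .inr (by linarith)

/-- Near a random-free graphon, closeness in the cut norm implies closeness in `L¹`; `δ` does not
depend on the coupling. -/
theorem IsRandomFree.exists_integral_abs_sub_le {Ω : Type u} [MeasurableSpace Ω] {μ : Measure Ω}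
    [IsProbabilityMeasure μ] {W : Graphon Ω} (hW : W.IsRandomFree μ) {ε : ℝ} (hε : 0 < ε) :
    ∃ δ > 0, ∀ {Ω' : Type w} [MeasurableSpace Ω'] (m : Measure Ω') [IsProbabilityMeasure m]
      (V : Graphon Ω') (ψ : Ω' → Ω), MeasurePreserving ψ m μ →
        cutNorm m (fun x y => V x y - W (ψ x) (ψ y)) < δ →
          ∫ p, |V p.1 p.2 - W (ψ p.1) (ψ p.2)| ∂(m.prod m) ≤ ε := by
  obtain ⟨ι, _, c, H, hc, -, -, hWH⟩ := W.exists_step_approx μ (ε := ε / 4) (by positivity)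
  set C : ℝ := ∑ i, ∑ j, |1 - 2 * H i j| with hC
  have hC0 : 0 ≤ C := Finset.sum_nonneg fun i _ => Finset.sum_nonneg fun j _ => abs_nonneg _
  refine ⟨ε / (2 * (C + 1)), by positivity, fun {Ω'} _ m _ V ψ hψ hlt => ?_⟩
  have hcψ : ∀ i, MeasurableSet ((c ∘ ψ) ⁻¹' {i}) := fun i => hψ.measurable (hc i)
  have hWψ : Integrable (fun p : Ω' × Ω' => W (ψ p.1) (ψ p.2)) (m.prod m) :=
    (W.comap ψ hψ.measurable).integrable _
  have hU : Integrable (fun p : Ω' × Ω' => V p.1 p.2 - W (ψ p.1) (ψ p.2)) (m.prod m) :=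
    (V.integrable _).sub hWψ
  have hHm : Measurable fun p : Ω × Ω => H (c p.1) (c p.2) :=
    IsStepFun.measurable ⟨ι, inferInstance, c, H, hc, fun _ => rfl⟩
  have hstep : ∀ K : ι → ι → ℝ, IsStepFun fun p : Ω' × Ω' => K (c (ψ p.1)) (c (ψ p.2)) :=
    fun K => ⟨ι, inferInstance, c ∘ ψ, K, hcψ, fun _ => rfl⟩
  have hUH : Integrable (fun p : Ω' × Ω' => (V p.1 p.2 - W (ψ p.1) (ψ p.2)) *
      (1 - 2 * H (c (ψ p.1)) (c (ψ p.2)))) (m.prod m) := by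
    have hs := hstep fun i j => 1 - 2 * H i j
    obtain ⟨D, hD⟩ := hs.exists_norm_le
    exact hU.mul_bdd hs.measurable.aestronglyMeasurable (.of_forall hD)
  have hWHi : Integrable (fun p : Ω' × Ω' => |W (ψ p.1) (ψ p.2) - H (c (ψ p.1)) (c (ψ p.2))|)
      (m.prod m) := (hWψ.sub ((hstep H).integrable _)).abs
  have hpull : ∫ p, |W (ψ p.1) (ψ p.2) - H (c (ψ p.1)) (c (ψ p.2))| ∂(m.prod m) ≤ ε / 4 :=
    (hψ.integral_comp_prod (f := fun x y => |W x y - H (c x) (c y)|)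
      (W.measurable_apply.sub hHm).abs).trans_le hWH
  have hrf : ∀ᵐ p ∂(m.prod m), W (ψ p.1) (ψ p.2) = 0 ∨ W (ψ p.1) (ψ p.2) = 1 :=
    (hψ.prod hψ).quasiMeasurePreserving.ae hW
  calc _ ≤ ∫ p : Ω' × Ω', ((V p.1 p.2 - W (ψ p.1) (ψ p.2)) * (1 - 2 * H (c (ψ p.1)) (c (ψ p.2))) +
        2 * |W (ψ p.1) (ψ p.2) - H (c (ψ p.1)) (c (ψ p.2))|) ∂(m.prod m) := by
        refine integral_mono_ae hU.abs (hUH.add (hWHi.const_mul 2)) ?_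
        filter_upwards [hrf] with p hp
        -- as `W` is `0` or `1` at `p`, `|V - W| = (V - W) * (1 - 2 * W)`
        have hV := V.mem_Icc' p.1 p.2
        have hE : |V p.1 p.2 - W (ψ p.1) (ψ p.2)| =
            (V p.1 p.2 - W (ψ p.1) (ψ p.2)) * (1 - 2 * W (ψ p.1) (ψ p.2)) := by
          rcases hp with h | h <;> rw [h]
          · rw [abs_of_nonneg (by linarith [hV.1])]; ring
          · rw [abs_of_nonpos (by linarith [hV.2])]; ring
        have hle : |V p.1 p.2 - W (ψ p.1) (ψ p.2)| ≤ 1 := by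
          have hW' := W.mem_Icc' (ψ p.1) (ψ p.2)
          rw [abs_le]
          constructor <;> linarith [hV.1, hV.2, hW'.1, hW'.2]
        have hmul : (V p.1 p.2 - W (ψ p.1) (ψ p.2)) *
            (H (c (ψ p.1)) (c (ψ p.2)) - W (ψ p.1) (ψ p.2)) ≤
              |W (ψ p.1) (ψ p.2) - H (c (ψ p.1)) (c (ψ p.2))| := by
          refine (le_abs_self _).trans ?_
          rw [abs_mul, abs_sub_comm (H _ _)]
          exact mul_le_of_le_one_left (abs_nonneg _) hle
        rw [hE]
        linear_combination 2 * hmul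
    _ ≤ C * cutNorm m (fun x y => V x y - W (ψ x) (ψ y)) + 2 * (ε / 4) := by
        rw [integral_add hUH (hWHi.const_mul 2), integral_const_mul]
        refine add_le_add ((le_abs_self _).trans ?_) (by gcongr)
        exact abs_integral_mul_step_le (U := fun x y => V x y - W (ψ x) (ψ y)) hcψ
          (fun i j => 1 - 2 * H i j) hU
    _ ≤ C * (ε / (2 * (C + 1))) + 2 * (ε / 4) := by gcongr
    _ ≤ ε := by
        have : C * (ε / (2 * (C + 1))) ≤ ε / 2 := by
          rw [mul_div_assoc', div_le_div_iff₀ (by positivity) (by positivity)]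
          nlinarith
        linarith

theorem IsRandomFree.tendsto_homDensity {Ω : Type u} [MeasurableSpace Ω] {μ : Measure Ω}
    [IsProbabilityMeasure μ] {W : Graphon Ω} (hW : W.IsRandomFree μ) {Ωs : ℕ → Type v}
    [∀ n, MeasurableSpace (Ωs n)] {μs : ∀ n, Measure (Ωs n)} [∀ n, IsProbabilityMeasure (μs n)]
    {Ws : ∀ n, Graphon (Ωs n)} (h : Tendsto (fun n => cutDist (μs n) (Ws n) μ W) atTop (𝓝 0))
    {V E : Type*} (F : Graph V E) [Fintype F.vertexSet] [Fintype F.edgeSet] [F.Loopless] :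
    Tendsto (fun n => homDensity F (μs n) (Ws n)) atTop (𝓝 (homDensity F μ W)) := by
  rw [Metric.tendsto_nhds]
  intro ε hε
  set k : ℝ := (Fintype.card F.edgeSet : ℝ)
  obtain ⟨δ, hδ, hδ'⟩ := hW.exists_integral_abs_sub_le.{u, max u v} (ε := ε / (k + 1))
    (by positivity)
  filter_upwards [h.eventually_lt_const hδ] with n hn
  obtain ⟨Ω', _, m, φ₁, φ₂, hm, h₁, h₂, hlt⟩ := exists_coupling_of_cutDist_lt hn
  have hle := hδ' m ((Ws n).comap φ₁ h₁.measurable) φ₂ h₂ hlt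
  rw [Real.dist_eq, ← homDensity_comap F (Ws n) h₁, ← homDensity_comap F W h₂]
  calc _ ≤ k * (ε / (k + 1)) :=
        (abs_homDensity_sub_le F m _ _).trans (mul_le_mul_of_nonneg_left hle (by positivity))
    _ < ε := by
        rw [mul_div_assoc', div_lt_iff₀ (by positivity)]
        nlinarith

end Graphon

theorem theorem10 {Ω : Type u} [MeasurableSpace Ω] (μ : Measure Ω) [IsProbabilityMeasure μ]
    (W : Graphon Ω) :
    List.TFAE
      [ W.IsRandomFree μ,
        ∀ (Ωs : ℕ → Type v) [∀ n, MeasurableSpace (Ωs n)] (μs : ∀ n, Measure (Ωs n))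
          [∀ n, IsProbabilityMeasure (μs n)] (Ws : ∀ n, Graphon (Ωs n)),
          Tendsto (fun n => cutDist (μs n) (Ws n) μ W) atTop (𝓝 0) →
            Tendsto (fun n => ∫ p, (Ws n) p.1 p.2 ^ 2 ∂((μs n).prod (μs n))) atTop
              (𝓝 (∫ p, W p.1 p.2 ^ 2 ∂(μ.prod μ))),
        ∀ (Ωs : ℕ → Type v) [∀ n, MeasurableSpace (Ωs n)] (μs : ∀ n, Measure (Ωs n))
          [∀ n, IsProbabilityMeasure (μs n)] (Ws : ∀ n, Graphon (Ωs n)),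
          Tendsto (fun n => cutDist (μs n) (Ws n) μ W) atTop (𝓝 0) →
            ∀ (V E : Type) (F : Graph V E) [Fintype F.vertexSet] [Fintype F.edgeSet]
              [F.Loopless],
              Tendsto (fun n => Graphon.homDensity F (μs n) (Ws n)) atTop
                (𝓝 (Graphon.homDensity F μ W)) ] := by
  tfae_have 1 → 3 := fun hW Ωs _ μs _ Ws h V E F _ _ _ => hW.tendsto_homDensity h F
  tfae_have 3 → 2 := by
    intro hW Ωs _ μs _ Ws h
    have : (Graph.banana false true (Set.univ : Set Bool)).Loopless :=
      ⟨fun e x => by simp [Graph.banana_isLoopAt]⟩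
    let _ := Fintype.ofFinite (Graph.banana false true (Set.univ : Set Bool)).vertexSet
    let _ := Fintype.ofFinite (Graph.banana false true (Set.univ : Set Bool)).edgeSet
    have hF := hW Ωs μs Ws h Bool Bool (Graph.banana false true Set.univ)
    simpa only [Graphon.homDensity_banana] using hF
  tfae_have 2 → 1 := by
    intro hW
    choose Y hYm ν hν G hG hcut using fun n : ℕ =>
      exists_zero_one_graphon_cutDist_le.{u, v} μ W (Nat.one_div_pos_of_nat (α := ℝ) (n := n))
    have hcut0 : Tendsto (fun n => cutDist (ν n) (G n) μ W) atTop (𝓝 0) :=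
      squeeze_zero (fun n => cutDist_nonneg) hcut tendsto_one_div_add_atTop_nhds_zero_nat
    have hsq := hW Y ν G hcut0
    have hint : Tendsto (fun n => ∫ p, G n p.1 p.2 ∂((ν n).prod (ν n))) atTop
        (𝓝 (∫ p, W p.1 p.2 ∂(μ.prod μ))) :=
      tendsto_iff_dist_tendsto_zero.2
        (squeeze_zero (fun n => dist_nonneg) (fun n => abs_integral_sub_le_cutDist) hcut0)
    -- `G n` takes only the values `0` and `1`, so it equals its square
    have heq : ∀ n, ∫ p, G n p.1 p.2 ^ 2 ∂((ν n).prod (ν n)) =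
        ∫ p, G n p.1 p.2 ∂((ν n).prod (ν n)) := fun n =>
      integral_congr_ae (.of_forall fun p => by
        rcases hG n p.1 p.2 with h | h <;> simp [h])
    exact W.isRandomFree_of_integral_sq_eq
      (tendsto_nhds_unique (hsq.congr heq) hint)
  tfae_finish
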